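/- Let $p\in(0,1]$ and $r\in(0,1)$ be fixed. The Markov random graph $G=G_{n}(p,r)$ is the random simple graph on the ordered vertex set $v_1,\dots,v_n$ defined as follows. For different $i$, the families of edge indicators $(X^i_j)_{1\le j<i}$, where $X^i_j=1$ if and only if $v_jv_i$ is an edge, are independent. For each $i\ge 2$ we have $\mathbb P(X^i_1=1)=p$, and for $1\le j\le i-2$, conditionally on $X^i_1,\dots,X^i_j$, the edge $v_{j+1}v_i$ is present with probability $\mathbb P(X^i_j=1)$ if $X^i_j=0$, and with probability $r\,\mathbb P(X^i_j=1)$ if $X^i_j=1$ (here $\mathbb P(X^i_j=1)$ is the unconditional probability). An event holds with high probability (w.h.p.) if its probability tends to $1$ as $n\to\infty$. Corollary. For every $\varepsilon>0$ there is a constant $c_\varepsilon>0$, depending on $\varepsilon$ only, such that for all $p\in(0,1]$ and $r\in(0,1)$: 1. w.h.p. $G$ contains a $K_t$-minor for some integer $t\ge c_\varepsilon\,\dfrac{\log n}{\sqrt{\log\log n}}$; 2. w.h.p. the line graph $L(G)$ contains a $K_s$-minor for some integer $s\ge c_\varepsilon\log n$. -/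

import Mathlib

open MeasureTheory Filter Topology

namespace MarkovRandomGraph

/-- The law on `Bool` that gives `true` probability `q` and `false` probability `1 - q`. -/
noncomputable def coin (q : unitInterval) : PMF Bool :=
  PMF.ofFintype (fun b => ENNReal.ofReal (if b then (q : ℝ) else 1 - (q : ℝ))) (by
    have h0 := q.2.1
    have h1 : 0 ≤ 1 - (q : ℝ) := sub_nonneg.2 q.2.2
    rw [Fintype.sum_bool]
    simp only [if_true, Bool.false_eq_true, if_false]
    rw [← ENNReal.ofReal_add h0 h1]
    simp)

/-- The (unconditional) probability that the last of the `m + 1` coordinates of a random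
0-1 sequence with law `μ` equals one. -/
noncomputable def lastProb {m : ℕ} (μ : PMF (Fin (m + 1) → Bool)) : unitInterval :=
  ⟨((μ.map fun x => x (Fin.last m)) true).toReal, ENNReal.toReal_nonneg,
    by simpa only [ENNReal.toReal_one] using
      ENNReal.toReal_mono ENNReal.one_ne_top (PMF.coe_le_one (μ.map fun x => x (Fin.last m)) true)⟩

/-- The joint law of the indicators of the first `m` potential edges
`(v₁, vᵢ), (v₂, vᵢ), …, (vₘ, vᵢ)` from a vertex `vᵢ` to earlier vertices. The first one is
present with probability `p`. Given the first `k ≥ 1` of them, the next edge is present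
with probability `ℙ(edge (vₖ, vᵢ) exists)` if the edge `(vₖ, vᵢ)` is absent, and with probability
`r * ℙ(edge (vₖ, vᵢ) exists)` if it is present. -/
noncomputable def rowLaw (p r : unitInterval) : (m : ℕ) → PMF (Fin m → Bool)
  | 0 => PMF.pure Fin.elim0
  | 1 => (coin p).map fun b _ => b
  | m + 2 =>
      (rowLaw p r (m + 1)).bind fun x =>
        (coin (if x (Fin.last m) then r * lastProb (rowLaw p r (m + 1))
            else lastProb (rowLaw p r (m + 1)))).map
          fun b => (Fin.snoc x b : Fin (m + 2) → Bool)

/-- Edge indicators of a graph on the ordered vertex set `Fin n`: the entry `x i j`, with `j < i`,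
tells whether vertex `i` is joined to the earlier vertex `j`. -/
abbrev EdgeArray (n : ℕ) : Type := (i : Fin n) → Fin (i : ℕ) → Bool

/-- The joint law of all edge indicators: rows of different vertices `i` are independent. -/
noncomputable def edgeLaw (p r : unitInterval) (n : ℕ) : Measure (EdgeArray n) :=
  Measure.pi fun i : Fin n => (rowLaw p r (i : ℕ)).toMeasure

/-- The simple graph with given edge indicators. -/
def toGraph {n : ℕ} (x : EdgeArray n) : SimpleGraph (Fin n) :=
  SimpleGraph.fromRel fun i j => ∃ h : j < i, x i ⟨j, h⟩ = true

/-- The probability that the Markov random graph on `n` vertices with initial probability `p`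
and decay parameter `r` has the property `P`. -/
noncomputable def graphProb (p r : unitInterval) (n : ℕ) (P : SimpleGraph (Fin n) → Prop) : ℝ :=
  (edgeLaw p r n).real {x | P (toGraph x)}

/-- A sequence of graph properties holds with high probability. -/
def WHP (p r : unitInterval) (P : (n : ℕ) → SimpleGraph (Fin n) → Prop) : Prop :=
  Tendsto (fun n => graphProb p r n (P n)) atTop (𝓝 1)

/-- `H` is a minor of `G`: there are pairwise disjoint connected (in particular nonempty) branch
sets in `G`, one for each vertex of `H`, with an edge of `G` between the branch sets of any two
adjacent vertices of `H`. -/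
def IsMinor {W V : Type*} (H : SimpleGraph W) (G : SimpleGraph V) : Prop :=
  ∃ B : W → Set V,
    (∀ w, (G.induce (B w)).Connected) ∧
    (∀ w w', w ≠ w' → Disjoint (B w) (B w')) ∧
    ∀ w w', H.Adj w w' → ∃ x ∈ B w, ∃ y ∈ B w', G.Adj x y

/-- `G` contains a `K_t`-minor. -/
def HasCompleteMinor {V : Type*} (G : SimpleGraph V) (t : ℕ) : Prop :=
  IsMinor (SimpleGraph.completeGraph (Fin t)) G

end MarkovRandomGraph

namespace MarkovRandomGraph

/-! The unconditional edge probabilities satisfy $q_{j+1} = q_j(1-(1-r)q_j)$, so $1/q_j$ grows at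
most linearly and edges to the first $k$ vertices have probability at least $1/(Ck)$, where $C = 1/p
+ 1/r$. The dependence inside a row costs only a factor $r$: a later vertex is joined to two given
vertices among the first $k$ with probability at least $\delta = r/(Ck)^2$.

Take $k = \lceil\log n\rceil + 1$ and reserve for each pair of the first $k$ vertices its own block
of $L = \lfloor\sqrt n\rfloor$ later vertices. Rows are independent, so a block contains no common
neighbour with probability at most $(1-\delta)^L$. A union bound (`edgeLaw_not_joinedInBlocks_le`)
gives failure probability $O(k^4/L) \to 0$.

Otherwise $G$ contains a subdivided $K_k$, hence a $K_k$-minor, and the first vertex has at least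
$k-1$ neighbours, hence a clique in $L(G)$ (`JoinedInBlocks.minors`). This gives $c = 1$, and order
$\log n$ even in the first part. -/

lemma coin_toReal (q : unitInterval) (b : Bool) :
    (coin q b).toReal = if b then (q : ℝ) else 1 - (q : ℝ) := by
  have h0 := q.2.1
  have h1 : 0 ≤ 1 - (q : ℝ) := sub_nonneg.2 q.2.2
  cases b <;> simp [coin, ENNReal.toReal_ofReal, h0, h1]

/-! ### The law of one row and the decay of its edge probabilities -/

/-- The real-valued probability of a 0-1 sequence under `rowLaw`. -/
noncomputable def rowWeight (p r : unitInterval) (m : ℕ) (x : Fin m → Bool) : ℝ :=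
  (rowLaw p r m x).toReal

/-- The unconditional probability of the edge to the vertex with index `j`. -/
noncomputable def edgeProb (p r : unitInterval) (j : ℕ) : unitInterval :=
  lastProb (rowLaw p r (j + 1))

lemma rowWeight_nonneg (p r : unitInterval) (m : ℕ) (x : Fin m → Bool) :
    0 ≤ rowWeight p r m x := ENNReal.toReal_nonneg

lemma sum_rowWeight (p r : unitInterval) (m : ℕ) : ∑ x, rowWeight p r m x = 1 := by
  have h := (rowLaw p r m).tsum_coe
  rw [tsum_fintype] at h
  unfold rowWeight
  rw [← ENNReal.toReal_sum (fun a _ => (rowLaw p r m).apply_ne_top a), h, ENNReal.toReal_one]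

lemma rowWeight_snoc (p r : unitInterval) (m : ℕ) (x : Fin (m + 1) → Bool) (b : Bool) :
    rowWeight p r (m + 2) (Fin.snoc x b) = rowWeight p r (m + 1) x *
      (coin (if x (Fin.last m) then r * edgeProb p r m else edgeProb p r m) b).toReal := by
  unfold rowWeight edgeProb
  rw [← ENNReal.toReal_mul, rowLaw, PMF.bind_apply, tsum_eq_single x]
  · congr 2
    rw [PMF.map_apply, tsum_eq_single b]
    · simp
    · intro b' hb'
      rw [if_neg]
      intro h
      exact hb' (Fin.snoc_injective2 (α := fun _ => Bool) h).2.symm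
  · intro x' hx'
    rw [PMF.map_apply]
    simp only [mul_eq_zero, ENNReal.tsum_eq_zero, ite_eq_right_iff]
    right
    intro b' h
    exact absurd (Fin.snoc_injective2 (α := fun _ => Bool) h).1.symm hx'

lemma sum_snoc {m : ℕ} (f : (Fin (m + 1) → Bool) → ℝ) :
    ∑ y, f y = ∑ x : Fin m → Bool, ∑ b : Bool, f (Fin.snoc x b) := by
  rw [← Equiv.sum_comp (Fin.snocEquiv fun _ : Fin (m + 1) => Bool), Fintype.sum_prod_type,
    Finset.sum_comm]
  rfl

/-- The real-valued probability of a set of 0-1 sequences under `rowLaw`. -/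
noncomputable def rowProb (p r : unitInterval) (m : ℕ) (A : Set (Fin m → Bool)) : ℝ :=
  ∑ x, A.indicator (rowWeight p r m) x

lemma measureReal_rowLaw (p r : unitInterval) (m : ℕ) (A : Set (Fin m → Bool)) :
    (rowLaw p r m).toMeasure.real A = rowProb p r m A := by
  classical
  rw [Measure.real, PMF.toMeasure_apply_fintype, ENNReal.toReal_sum, rowProb]
  · refine Finset.sum_congr rfl fun x _ => ?_
    by_cases h : x ∈ A <;> simp [h, rowWeight]
  · intro x _
    by_cases h : x ∈ A <;> simp [h, PMF.apply_ne_top]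

lemma edgeProb_eq (p r : unitInterval) (m : ℕ) :
    (edgeProb p r m : ℝ) = rowProb p r (m + 1) {x | x (Fin.last m) = true} := by
  classical
  rw [← measureReal_rowLaw]
  change ((PMF.map _ _) true).toReal = _
  rw [Measure.real, ← PMF.toMeasure_apply_singleton _ _ (measurableSet_singleton _),
    PMF.toMeasure_map_apply _ _ _ (measurable_of_finite _) (measurableSet_singleton _)]
  rfl

lemma edgeProb_zero (p r : unitInterval) : (edgeProb p r 0 : ℝ) = p := by
  change ((PMF.map _ (rowLaw p r 1)) true).toReal = _
  rw [rowLaw, PMF.map_comp]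
  change ((PMF.map id (coin p)) true).toReal = _
  rw [PMF.map_id, coin_toReal]
  simp

lemma rowProb_init (p r : unitInterval) (m : ℕ) (A : Set (Fin (m + 1) → Bool)) :
    rowProb p r (m + 2) {y | (fun i => y (Fin.castSucc i)) ∈ A} = rowProb p r (m + 1) A := by
  classical
  rw [rowProb, sum_snoc, rowProb]
  refine Finset.sum_congr rfl fun x _ => ?_
  by_cases h : x ∈ A
  · simp [Set.indicator, h, rowWeight_snoc, coin_toReal]; ring
  · simp [Set.indicator, h]

/-- Whatever the past, the next edge has conditional probability $q_m$ or $r q_m$, hence at least $r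
q_m$. -/
lemma rowProb_init_inter_last (p r : unitInterval) (m : ℕ) (A : Set (Fin (m + 1) → Bool)) :
    r * edgeProb p r m * rowProb p r (m + 1) A ≤
      rowProb p r (m + 2)
        {y | (fun i => y (Fin.castSucc i)) ∈ A ∧ y (Fin.last (m + 1)) = true} := by
  classical
  rw [rowProb, rowProb, sum_snoc (m := m + 1), Finset.mul_sum]
  refine Finset.sum_le_sum fun x _ => ?_
  have hw := rowWeight_nonneg p r (m + 1) x
  have hq := (edgeProb p r m).2.1
  by_cases h : x ∈ A
  · by_cases hx : x (Fin.last m) = true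
    · simp [Set.indicator, h, hx, rowWeight_snoc, coin_toReal]
      exact le_of_eq (by ring)
    · simp [Set.indicator, h, hx, rowWeight_snoc, coin_toReal]
      nlinarith [mul_nonneg hw hq, r.2.2]
  · simp [Set.indicator, h]

/-- Conditioning on the preceding edge, itself present with probability $q$, gives $(1-q)q + q \cdot
rq$. -/
lemma edgeProb_succ (p r : unitInterval) (m : ℕ) :
    (edgeProb p r (m + 1) : ℝ) = edgeProb p r m * (1 - (1 - r) * edgeProb p r m) := by
  classical
  have h1 := sum_rowWeight p r (m + 1)
  have h2 := edgeProb_eq p r m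
  rw [edgeProb_eq, rowProb, sum_snoc]
  rw [rowProb] at h2
  set q := edgeProb p r m with hq
  have : ∀ x : Fin (m + 1) → Bool, ∑ b : Bool,
      Set.indicator {y : Fin (m + 2) → Bool | y (Fin.last (m + 1)) = true}
        (rowWeight p r (m + 2)) (Fin.snoc x b) =
      q * rowWeight p r (m + 1) x - q * (1 - r) *
        Set.indicator {x | x (Fin.last m) = true} (rowWeight p r (m + 1)) x := by
    intro x
    by_cases hx : x (Fin.last m) = true
    · simp [Set.indicator, hx, rowWeight_snoc, coin_toReal, ← hq]; ring
    · simp [Set.indicator, hx, rowWeight_snoc, coin_toReal, ← hq]; ring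
  rw [Finset.sum_congr rfl fun x _ => this x, Finset.sum_sub_distrib, ← Finset.mul_sum,
    ← Finset.mul_sum, h1, ← h2]
  ring

/-- Inverting the recursion, $1/q$ increases by $(1-r)/(1-(1-r)q)$ at each step. This is at most
$1/r$, because $q \le 1$ makes the denominator at least $r$. -/
lemma edgeProb_pos_inv_le (p r : unitInterval) (hp : 0 < p) (hr : 0 < r) (j : ℕ) :
    0 < (edgeProb p r j : ℝ) ∧ (edgeProb p r j : ℝ)⁻¹ ≤ (p : ℝ)⁻¹ + j * (r : ℝ)⁻¹ := by
  have hp' : (0 : ℝ) < p := hp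
  have hr' : (0 : ℝ) < r := hr
  induction j with
  | zero => simp [edgeProb_zero, hp']
  | succ j ih =>
    obtain ⟨h0, h⟩ := ih
    have h1 := (edgeProb p r j).2.2
    have hr1 := r.2.2
    set q : ℝ := (edgeProb p r j : ℝ)
    have hs : (r : ℝ) ≤ 1 - (1 - r) * q := by nlinarith
    rw [edgeProb_succ]
    refine ⟨mul_pos h0 (hr'.trans_le hs), ?_⟩
    have hs' : (0 : ℝ) < 1 - (1 - r) * q := hr'.trans_le hs
    have : (q * (1 - (1 - r) * q))⁻¹ = q⁻¹ + (1 - r) * (1 - (1 - r) * q)⁻¹ := by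
      have e1 := mul_inv_cancel₀ hs'.ne'
      have e2 := mul_inv_cancel₀ h0.ne'
      rw [mul_inv]
      generalize (1 - (1 - (r : ℝ)) * q)⁻¹ = d at e1 ⊢
      linear_combination q⁻¹ * e1 + (1 - (r : ℝ)) * d * e2
    have h3 : (1 - (1 - r) * q)⁻¹ ≤ (r : ℝ)⁻¹ := inv_anti₀ hr' hs
    have h4 : (0 : ℝ) < (1 - (1 - r) * q)⁻¹ := inv_pos.2 hs'
    rw [this]
    push_cast
    nlinarith

lemma rowProb_apply_eq (p r : unitInterval) (a m : ℕ) (h : a < m) :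
    rowProb p r m {x | x ⟨a, h⟩ = true} = edgeProb p r a := by
  induction m, h using Nat.le_induction with
  | base => exact (edgeProb_eq p r a).symm
  | succ m h ih =>
    obtain ⟨m, rfl⟩ : ∃ m', m = m' + 1 := ⟨m - 1, by omega⟩
    rw [← ih, ← rowProb_init p r m]
    rfl

/-- The event at $a$ is part of the past of coordinate $b+1$; the coordinates after $b+1$ are summed
out. -/
lemma le_rowProb_pair (p r : unitInterval) (a b m : ℕ) (hab : a < b + 1) (hb : b + 1 < m) :
    (r : ℝ) * edgeProb p r b * edgeProb p r a ≤
      rowProb p r m {x | x ⟨a, hab.trans hb⟩ = true ∧ x ⟨b + 1, hb⟩ = true} := by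
  induction m, hb using Nat.le_induction with
  | base =>
    rw [← rowProb_apply_eq p r a (b + 1) hab]
    exact rowProb_init_inter_last p r b _
  | succ m h ih =>
    obtain ⟨m, rfl⟩ : ∃ m', m = m' + 1 := ⟨m - 1, by omega⟩
    refine ih.trans (le_of_eq ?_)
    rw [← rowProb_init p r m]
    rfl

/-- The reciprocal of `k` times this constant bounds the probabilities of the edges to the first
`k` vertices from below. -/
noncomputable def invRate (p r : unitInterval) : ℝ := (p : ℝ)⁻¹ + (r : ℝ)⁻¹

lemma le_edgeProb (p r : unitInterval) (hp : 0 < p) (hr : 0 < r) {j k : ℕ} (h : j < k) :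
    (invRate p r * k)⁻¹ ≤ edgeProb p r j := by
  obtain ⟨h0, h1⟩ := edgeProb_pos_inv_le p r hp hr j
  have hp' : (0 : ℝ) < (p : ℝ)⁻¹ := inv_pos.2 hp
  have hr' : (0 : ℝ) < (r : ℝ)⁻¹ := inv_pos.2 hr
  refine inv_le_of_inv_le₀ h0 (h1.trans ?_)
  have h2 : (j : ℝ) + 1 ≤ k := by exact_mod_cast h
  have h3 : (0 : ℝ) ≤ j := j.cast_nonneg
  unfold invRate
  nlinarith

lemma le_measureReal_pair (p r : unitInterval) (hp : 0 < p) (hr : 0 < r) {a b k m : ℕ}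
    (hab : a < b) (hb : b < k) (hk : k ≤ m) :
    (r : ℝ) * ((invRate p r * k)⁻¹) ^ 2 ≤ (rowLaw p r m).toMeasure.real
      {x | x ⟨a, by omega⟩ = true ∧ x ⟨b, by omega⟩ = true} := by
  obtain ⟨b, rfl⟩ : ∃ b', b = b' + 1 := ⟨b - 1, by omega⟩
  rw [measureReal_rowLaw]
  refine le_trans ?_ (le_rowProb_pair p r a b m hab (by omega))
  have h1 := le_edgeProb p r hp hr (j := b) (k := k) (by omega)
  have h2 := le_edgeProb p r hp hr (j := a) (k := k) (by omega)
  have hp' : (0 : ℝ) < (p : ℝ)⁻¹ := inv_pos.2 hp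
  have hr' : (0 : ℝ) < (r : ℝ)⁻¹ := inv_pos.2 hr
  have h0 : 0 ≤ (invRate p r * k)⁻¹ := by unfold invRate; positivity
  have := r.2.1
  rw [sq, mul_assoc]
  gcongr
  exact h0.trans h1

/-- By injectivity of `f` the event is a box in the product measure, constraining $L$ distinct rows.
-/
lemma edgeLaw_forall_le (p r : unitInterval) (n L : ℕ) (f : Fin L → Fin n)
    (hf : Function.Injective f) (N : (i : Fin n) → Set (Fin (i : ℕ) → Bool)) (δ : ℝ)
    (hN : ∀ l, (rowLaw p r (f l : ℕ)).toMeasure.real (N (f l)) ≤ δ) :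
    (edgeLaw p r n).real {x | ∀ l, x (f l) ∈ N (f l)} ≤ δ ^ L := by
  classical
  have : {x : EdgeArray n | ∀ l, x (f l) ∈ N (f l)} =
      Set.univ.pi fun i => if i ∈ Finset.univ.image f then N i else Set.univ := by
    ext x
    simp only [Set.mem_ofPred_eq, Set.mem_univ_pi]
    constructor
    · intro h i
      split_ifs with hi
      · obtain ⟨l, -, rfl⟩ := Finset.mem_image.1 hi
        exact h l
      · trivial
    · intro h l
      simpa using h (f l)
  rw [this, edgeLaw, Measure.real, Measure.pi_pi, ENNReal.toReal_prod]
  have h2 : ∀ i : Fin n, ((rowLaw p r (i : ℕ)).toMeasure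
      (if i ∈ Finset.univ.image f then N i else Set.univ)).toReal =
      if i ∈ Finset.univ.image f then (rowLaw p r (i : ℕ)).toMeasure.real (N i) else 1 := by
    intro i
    split_ifs <;> simp [Measure.real]
  rw [Finset.prod_congr rfl fun i _ => h2 i, Finset.prod_ite_mem, Finset.univ_inter,
    Finset.prod_image fun _ _ _ _ h => hf h]
  refine (Finset.prod_le_prod (fun _ _ => measureReal_nonneg) fun l _ => hN l).trans ?_
  simp

/-! ### Complete minors from cliques, subdivisions and stars -/

lemma hasCompleteMinor_of_pairwise_adj {V : Type*} {G : SimpleGraph V} {t : ℕ} (f : Fin t → V)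
    (h : Pairwise fun a b => G.Adj (f a) (f b)) : HasCompleteMinor G t := by
  refine ⟨fun a => {f a}, fun a => ?_, fun a b hab => ?_, fun a b hab => ?_⟩
  · have : Nonempty ({f a} : Set V) := ⟨⟨f a, rfl⟩⟩
    exact ⟨fun x y => by rw [Subsingleton.elim x y]⟩
  · exact Set.disjoint_singleton.2 (h hab).ne
  · exact ⟨f a, rfl, f b, rfl, h hab.ne⟩

/-- Each branch set is a star: `v a` together with the subdividing vertices towards larger indices.
Disjointness therefore needs `w` to determine only the smaller index. -/
lemma HasCompleteMinor.of_subdivision {V : Type*} {G : SimpleGraph V} {k : ℕ} (v : Fin k → V)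
    (hv : Function.Injective v) (w : Fin k → Fin k → V)
    (hw : ∀ a b a' b', a < b → a' < b' → w a b = w a' b' → a = a')
    (hvw : ∀ a b c, a < b → w a b ≠ v c)
    (h1 : ∀ a b, a < b → G.Adj (v a) (w a b)) (h2 : ∀ a b, a < b → G.Adj (w a b) (v b)) :
    HasCompleteMinor G k := by
  refine ⟨fun a => insert (v a) {y | ∃ b, a < b ∧ w a b = y}, fun a => ?_, fun a a' ha => ?_,
    fun a b hab => ?_⟩
  · rw [SimpleGraph.connected_iff_exists_forall_reachable]
    refine ⟨⟨v a, Set.mem_insert _ _⟩, ?_⟩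
    rintro ⟨y, rfl | ⟨b, hb, rfl⟩⟩
    · exact SimpleGraph.Reachable.refl _
    · exact SimpleGraph.Adj.reachable (h1 a b hb)
  · rw [Set.disjoint_left]
    rintro y (rfl | ⟨b, hb, rfl⟩) (h | ⟨b', hb', h⟩)
    · exact ha (hv h)
    · exact hvw _ _ _ hb' h
    · exact hvw _ _ _ hb h
    · exact ha (hw _ _ _ _ hb hb' h.symm)
  · rcases lt_or_gt_of_ne (show a ≠ b from hab.ne) with h | h
    · exact ⟨w a b, Or.inr ⟨b, h, rfl⟩, v b, Or.inl rfl, h2 a b h⟩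
    · exact ⟨v a, Or.inl rfl, w b a, Or.inr ⟨a, h, rfl⟩, (h2 b a h).symm⟩

lemma hasCompleteMinor_lineGraph_of_star {V : Type*} {G : SimpleGraph V} {s : ℕ} (v : V)
    (w : Fin s → V) (hw : Function.Injective w) (h : ∀ a, G.Adj v (w a)) :
    HasCompleteMinor G.lineGraph s := by
  refine hasCompleteMinor_of_pairwise_adj (fun a => ⟨s(v, w a), G.mem_edgeSet.2 (h a)⟩)
    fun a b hab => ?_
  refine SimpleGraph.lineGraph_adj_iff_exists.2 ?_
  refine ⟨?_, v, by simp, by simp⟩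
  intro e
  rw [Subtype.mk.injEq, Sym2.congr_right] at e
  exact hab (hw e)

lemma toGraph_adj {n : ℕ} (x : EdgeArray n) {i j : Fin n} (h : j < i) (hx : x i ⟨j, h⟩ = true) :
    (toGraph x).Adj j i := by
  rw [toGraph, SimpleGraph.fromRel_adj]
  exact ⟨h.ne, Or.inr ⟨h, hx⟩⟩

/-! ### Reserved blocks of connecting vertices -/

/-- Disjoint blocks of `L` vertices, one for each pair of the first `k` vertices. -/
def block {n k L : ℕ} (h : k + k * k * L ≤ n) (z : (Fin k × Fin k) × Fin L) : Fin n :=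
  Fin.castLE h (Fin.natAdd k (finProdFinEquiv (finProdFinEquiv z.1, z.2)))

lemma block_injective {n k L : ℕ} (h : k + k * k * L ≤ n) : Function.Injective (block h) := by
  rintro ⟨z, l⟩ ⟨z', l'⟩ e
  simpa [block] using e

lemma le_block {n k L : ℕ} (h : k + k * k * L ≤ n) (z : (Fin k × Fin k) × Fin L) :
    k ≤ block h z := by
  simp [block]

/-- Every pair of the first `k` vertices has a common neighbour in the block of that pair. -/
def JoinedInBlocks {n k L : ℕ} (h : k + k * k * L ≤ n) (x : EdgeArray n) : Prop :=
  ∀ a b : Fin k, a < b → ∃ l : Fin L,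
    x (block h ((a, b), l)) ⟨a, a.2.trans_le (le_block h _)⟩ = true ∧
    x (block h ((a, b), l)) ⟨b, b.2.trans_le (le_block h _)⟩ = true

lemma JoinedInBlocks.minors {n k L : ℕ} {h : k + 1 + (k + 1) * (k + 1) * L ≤ n} {x : EdgeArray n}
    (hx : JoinedInBlocks h x) :
    HasCompleteMinor (toGraph x) (k + 1) ∧ HasCompleteMinor (toGraph x).lineGraph k := by
  have hkn : k + 1 ≤ n := (Nat.le_add_right _ _).trans h
  have : ∀ a b : Fin (k + 1), ∃ y : Fin n, a < b →
      (∃ l, y = block h ((a, b), l)) ∧ (toGraph x).Adj (Fin.castLE hkn a) y ∧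
        (toGraph x).Adj (Fin.castLE hkn b) y := by
    intro a b
    by_cases hab : a < b
    · obtain ⟨l, h1, h2⟩ := hx a b hab
      exact ⟨block h ((a, b), l), fun _ => ⟨⟨l, rfl⟩, toGraph_adj x _ h1, toGraph_adj x _ h2⟩⟩
    -- A dummy value: only pairs with `a < b` are used.
    · exact ⟨⟨0, by omega⟩, fun hab' => absurd hab' hab⟩
  choose w hw using this
  have hinj : ∀ a b a' b', a < b → a' < b' → w a b = w a' b' → a = a' ∧ b = b' := by
    intro a b a' b' hab hab' e
    obtain ⟨l, hl⟩ := (hw a b hab).1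
    obtain ⟨l', hl'⟩ := (hw a' b' hab').1
    rw [hl, hl'] at e
    have := block_injective h e
    simp only [Prod.mk.injEq] at this
    exact this.1
  constructor
  · refine HasCompleteMinor.of_subdivision (Fin.castLE hkn) (Fin.castLE_injective hkn) w
      (fun a b a' b' hab hab' e => (hinj a b a' b' hab hab' e).1) (fun a b c hab e => ?_)
      (fun a b hab => (hw a b hab).2.1) (fun a b hab => (hw a b hab).2.2.symm)
    obtain ⟨l, hl⟩ := (hw a b hab).1
    have h1 := le_block h ((a, b), l)
    rw [← hl, e] at h1
    exact absurd c.2 (not_lt.2 h1)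
  · exact hasCompleteMinor_lineGraph_of_star (Fin.castLE hkn 0) (fun b => w 0 b.succ)
      (fun b b' e => Fin.succ_injective _
        (hinj _ _ _ _ (Fin.succ_pos _) (Fin.succ_pos _) e).2)
      (fun b => (hw 0 b.succ (Fin.succ_pos _)).2.1)

instance (p r : unitInterval) (n : ℕ) : IsProbabilityMeasure (edgeLaw p r n) := by
  unfold edgeLaw
  infer_instance

lemma edgeLaw_not_joinedInBlocks_le (p r : unitInterval) (hp : 0 < p) (hr : 0 < r) {n k L : ℕ}
    (hk : 0 < k) (hL : 0 < L) (h : k + k * k * L ≤ n) :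
    (edgeLaw p r n).real {x | ¬ JoinedInBlocks h x} ≤
      (invRate p r ^ 2 / r) * ((k : ℝ) ^ 4 / L) := by
  classical
  have hp' : (0 : ℝ) < (p : ℝ)⁻¹ := inv_pos.2 hp
  have hr0 : (0 : ℝ) < r := hr
  have hr' : (0 : ℝ) < (r : ℝ)⁻¹ := inv_pos.2 hr
  have hC : 0 < invRate p r := add_pos hp' hr'
  have hk' : (0 : ℝ) < k := by exact_mod_cast hk
  have hL' : (0 : ℝ) < L := by exact_mod_cast hL
  set δ : ℝ := (r : ℝ) * ((invRate p r * k)⁻¹) ^ 2 with hδ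
  have hδ0 : 0 < δ := by positivity
  -- The rows missing at least one edge of the pair. Placing `k ≤ i` inside the set makes it
  -- meaningful for every `i` (empty for `i < k`).
  let N : Fin k × Fin k → (i : Fin n) → Set (Fin (i : ℕ) → Bool) := fun z i =>
    {y | ∃ hi : k ≤ i, z.1 < z.2 →
      ¬ (y ⟨z.1, z.1.2.trans_le hi⟩ = true ∧ y ⟨z.2, z.2.2.trans_le hi⟩ = true)}
  have hsub : {x | ¬ JoinedInBlocks h x} ⊆ ⋃ z ∈ Finset.univ.filter
      (fun z : Fin k × Fin k => z.1 < z.2),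
      {x : EdgeArray n | ∀ l, x (block h (z, l)) ∈ N z (block h (z, l))} := by
    intro x hx
    simp only [JoinedInBlocks, Set.mem_ofPred_eq, not_forall, not_exists] at hx
    obtain ⟨a, b, hab, hx⟩ := hx
    refine Set.mem_biUnion (x := (a, b)) (by simpa using hab) fun l => ?_
    exact ⟨le_block h _, fun _ => hx l⟩
  have hz : ∀ z ∈ Finset.univ.filter (fun z : Fin k × Fin k => z.1 < z.2),
      (edgeLaw p r n).real {x | ∀ l, x (block h (z, l)) ∈ N z (block h (z, l))} ≤
        (δ * L)⁻¹ := by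
    rintro ⟨a, b⟩ hab
    replace hab : a < b := by simpa using hab
    have hle : ∀ i : Fin n, k ≤ i → δ ≤ 1 ∧
        (rowLaw p r (i : ℕ)).toMeasure.real (N (a, b) i) ≤ 1 - δ := by
      intro i hi
      have h1 := le_measureReal_pair p r hp hr (show (a : ℕ) < b from hab) b.2 hi
      refine ⟨h1.trans measureReal_le_one, ?_⟩
      have h2 : N (a, b) i = {x : Fin (i : ℕ) → Bool | x ⟨a, a.2.trans_le hi⟩ = true ∧
          x ⟨b, b.2.trans_le hi⟩ = true}ᶜ := by
        ext y
        exact ⟨fun ⟨_, hy⟩ => hy hab, fun hy => ⟨hi, fun _ => hy⟩⟩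
      rw [h2, measureReal_compl (Set.toFinite _).measurableSet, probReal_univ]
      exact sub_le_sub_left h1 1
    refine (edgeLaw_forall_le p r n L (fun l => block h ((a, b), l))
      (fun l l' e => by simpa using block_injective h e) (N (a, b)) (1 - δ)
      fun l => (hle _ (le_block h _)).2).trans ?_
    have hδ1 : δ ≤ 1 := (hle _ (le_block h ((a, b), ⟨0, hL⟩))).1
    -- The exponential bound is weakened to $1/(\delta L)$, which suffices as $k$ is logarithmic and
    -- $L$ a power of $n$.
    calc (1 - δ) ^ L ≤ Real.exp (-δ) ^ L := by
          exact pow_le_pow_left₀ (sub_nonneg.2 hδ1) (Real.one_sub_le_exp_neg δ) L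
      _ = (Real.exp (δ * L))⁻¹ := by rw [← Real.exp_nat_mul, ← Real.exp_neg]; ring_nf
      _ ≤ (δ * L)⁻¹ := by
          gcongr
          linarith [Real.add_one_le_exp (δ * L)]
  refine (measureReal_mono hsub (measure_ne_top _ _)).trans ((measureReal_biUnion_finset_le _ _).trans
    ((Finset.sum_le_sum hz).trans ?_))
  rw [Finset.sum_const, nsmul_eq_mul]
  have hcard : ((Finset.univ.filter (fun z : Fin k × Fin k => z.1 < z.2)).card : ℝ) ≤ k * k := by
    have := Finset.card_filter_le (Finset.univ : Finset (Fin k × Fin k)) (fun z => z.1 < z.2)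
    rw [Finset.card_univ, Fintype.card_prod, Fintype.card_fin] at this
    exact_mod_cast this
  calc _ ≤ (k * k : ℝ) * (δ * L)⁻¹ := by gcongr
    _ = _ := by rw [hδ]; field_simp

/-! ### Asymptotics for the choice of $k$ and $L$ -/

lemma tendsto_ceil_log_pow_div_sqrt :
    Tendsto (fun n : ℕ => ((⌈Real.log n⌉₊ + 1 : ℕ) : ℝ) ^ 4 / (Nat.sqrt n : ℕ)) atTop (𝓝 0) := by
  have hlog : Tendsto (fun n : ℕ => Real.log n) atTop atTop :=
    Real.tendsto_log_atTop.comp tendsto_natCast_atTop_atTop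
  have h1 : Tendsto (fun n : ℕ => Real.log n ^ 8 / n) atTop (𝓝 0) :=
    (Real.isLittleO_pow_log_id_atTop (n := 8)).tendsto_div_nhds_zero.comp tendsto_natCast_atTop_atTop
  -- Here $162 = 3^4 \cdot 2$, from $k \le 3\log n$ and $\sqrt n \le 2\lfloor\sqrt n\rfloor$.
  have h2 : Tendsto (fun n : ℕ => 162 * √(Real.log n ^ 8 / n)) atTop (𝓝 0) := by
    simpa using (h1.sqrt).const_mul 162
  refine squeeze_zero' (Eventually.of_forall fun n => by positivity) ?_ h2
  filter_upwards [hlog.eventually_ge_atTop 1, eventually_ge_atTop 1] with n hn hn1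
  have hk : ((⌈Real.log n⌉₊ + 1 : ℕ) : ℝ) ≤ 3 * Real.log n := by
    have := Nat.ceil_lt_add_one (zero_le_one.trans hn)
    push_cast
    linarith
  have hs1 : 1 ≤ Nat.sqrt n := Nat.le_sqrt.2 (by simpa using hn1)
  have hs1' : (1 : ℝ) ≤ Nat.sqrt n := by exact_mod_cast hs1
  have hs : √(n : ℝ) ≤ 2 * Nat.sqrt n := by
    have : √(n : ℝ) ≤ Nat.sqrt n + 1 := Real.real_sqrt_le_nat_sqrt_succ
    linarith
  have hpos : 0 < √(n : ℝ) := Real.sqrt_pos.2 (by exact_mod_cast hn1)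
  have h8 : √(Real.log n ^ 8 / n) = Real.log n ^ 4 / √(n : ℝ) := by
    rw [Real.sqrt_div (by positivity), show Real.log n ^ 8 = (Real.log n ^ 4) ^ 2 by ring,
      Real.sqrt_sq (by positivity)]
  rw [h8]
  calc ((⌈Real.log n⌉₊ + 1 : ℕ) : ℝ) ^ 4 / (Nat.sqrt n : ℕ)
      ≤ (3 * Real.log n) ^ 4 / (√(n : ℝ) / 2) := by
        gcongr
        linarith
    _ = _ := by field_simp; ring

lemma eventually_blocks_fit :
    ∀ᶠ n : ℕ in atTop, 0 < Nat.sqrt n ∧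
      ⌈Real.log n⌉₊ + 1 + (⌈Real.log n⌉₊ + 1) * (⌈Real.log n⌉₊ + 1) * Nat.sqrt n ≤ n := by
  have hlog : Tendsto (fun n : ℕ => Real.log n) atTop atTop :=
    Real.tendsto_log_atTop.comp tendsto_natCast_atTop_atTop
  filter_upwards [tendsto_ceil_log_pow_div_sqrt.eventually (gt_mem_nhds zero_lt_one),
    hlog.eventually_ge_atTop 1, eventually_ge_atTop 1] with n h hn hn1
  have hs1 : 1 ≤ Nat.sqrt n := Nat.le_sqrt.2 (by simpa using hn1)
  have hk : 2 ≤ ⌈Real.log n⌉₊ + 1 := by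
    have : 0 < ⌈Real.log n⌉₊ := Nat.ceil_pos.2 (zero_lt_one.trans_le hn)
    omega
  generalize ⌈Real.log n⌉₊ + 1 = k at *
  rw [div_lt_one (by exact_mod_cast hs1)] at h
  have h4 : k ^ 4 < Nat.sqrt n := by exact_mod_cast h
  refine ⟨hs1, le_trans ?_ (Nat.sqrt_le n)⟩
  generalize Nat.sqrt n = L at *
  have h2 : 4 ≤ k * k := by nlinarith
  -- Since also $k \le L$, this yields $k + k^2L \le (k^2+1)L \le L^2 \le n$.
  have h3 : k * k + 1 ≤ L := by nlinarith
  nlinarith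

lemma WHP.of_joinedInBlocks (p r : unitInterval) (hp : 0 < p) (hr : 0 < r)
    (P : (n : ℕ) → SimpleGraph (Fin n) → Prop)
    (hP : ∀ᶠ n : ℕ in atTop, ∀ (h : ⌈Real.log n⌉₊ + 1 +
      (⌈Real.log n⌉₊ + 1) * (⌈Real.log n⌉₊ + 1) * Nat.sqrt n ≤ n) (x : EdgeArray n),
      JoinedInBlocks h x → P n (toGraph x)) : WHP p r P := by
  have hlim := (tendsto_ceil_log_pow_div_sqrt.const_mul (invRate p r ^ 2 / r)).const_sub 1
  rw [mul_zero, sub_zero] at hlim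
  refine tendsto_of_tendsto_of_tendsto_of_le_of_le' hlim tendsto_const_nhds ?_
    (Eventually.of_forall fun n => measureReal_le_one)
  filter_upwards [hP, eventually_blocks_fit] with n hP ⟨hL, h⟩
  have h1 := edgeLaw_not_joinedInBlocks_le p r hp hr (Nat.succ_pos _) hL h
  have h2 : {x | ¬ JoinedInBlocks h x}ᶜ ⊆ {x | P n (toGraph x)} :=
    fun x hx => hP h x (not_not.1 hx)
  have h3 := measureReal_mono (μ := edgeLaw p r n) h2 (measure_ne_top _ _)
  rw [measureReal_compl (Set.toFinite _).measurableSet, probReal_univ] at h3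
  exact (sub_le_sub_left h1 1).trans h3

end MarkovRandomGraph

theorem mainTheorem11 :
    ∀ ε : ℝ, 0 < ε → ∃ c : ℝ, 0 < c ∧
      ∀ p r : unitInterval, 0 < p → 0 < r → r < 1 →
        MarkovRandomGraph.WHP p r (fun n G =>
          ∃ t : ℕ, c * (Real.log n / √(Real.log (Real.log n))) ≤ t ∧
            MarkovRandomGraph.HasCompleteMinor G t) ∧
        MarkovRandomGraph.WHP p r (fun n G =>
          ∃ s : ℕ, c * Real.log n ≤ s ∧
            MarkovRandomGraph.HasCompleteMinor G.lineGraph s) := by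
  intro _ _
  refine ⟨1, one_pos, fun p r hp hr _ => ⟨?_, ?_⟩⟩
  · refine MarkovRandomGraph.WHP.of_joinedInBlocks p r hp hr _ ?_
    have hlog : Tendsto (fun n : ℕ => Real.log n) atTop atTop :=
      Real.tendsto_log_atTop.comp tendsto_natCast_atTop_atTop
    -- Once $\log\log n \ge 1$, dividing by its square root only lowers the target below $\log n$.
    filter_upwards [hlog.eventually_ge_atTop 0,
      (Real.tendsto_log_atTop.comp hlog).eventually_ge_atTop 1] with n h0 h1 h x hx
    refine ⟨_, ?_, hx.minors.1⟩
    rw [one_mul]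
    refine (div_le_self h0 (Real.one_le_sqrt.2 h1)).trans ((Nat.le_ceil _).trans ?_)
    exact_mod_cast Nat.le_succ _
  · refine MarkovRandomGraph.WHP.of_joinedInBlocks p r hp hr _ ?_
    exact Eventually.of_forall fun n h x hx =>
      ⟨_, by rw [one_mul]; exact Nat.le_ceil _, hx.minors.2⟩
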